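/- Let $T$ be a complete first-order theory in a language $L$, and let $\mathbb{M}\models T$ be a monster model: for some cardinal $\kappa>|L|+\aleph_0$, $\mathbb{M}$ is $\kappa$-saturated and strongly $\kappa$-homogeneous. A subset of $\mathbb{M}$ is called small if it has fewer than $\kappa$ elements; below, $M$ ranges over the small elementary substructures of $\mathbb{M}$, the letters $a,a',b,b_i,c_i$ denote finite tuples from $\mathbb{M}$, and $B,B'$ denote small subsets of $\mathbb{M}$. In the relation below a tuple stands for the set of its coordinates, juxtaposition denotes union, and $a\equiv_C b$ means $\operatorname{tp}(a/C)=\operatorname{tp}(b/C)$. Suppose that there is an $\operatorname{Aut}(\mathbb{M})$-invariant ternary relation $A\perp_C B$ on small subsets of $\mathbb{M}$ such that for all such $M$ and all such tuples and sets: 1. (Strong finite character) if $a\not\perp_M b$, then there is a formula $\varphi(x,b,m)\in\operatorname{tp}(a/bM)$, with $m$ a tuple from $M$, such that $a'\not\perp_M b$ for every $a'$ with $\mathbb{M}\models\varphi(a',b,m)$; 2. (Existence over models) $a\perp_M M$; 3. (Monotonicity) $aa'\perp_M BB'$ implies $a\perp_M B$; 4. (Symmetry) $a\perp_M b$ if and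 only if $b\perp_M a$; 5. (Independent amalgamation) if $c_0\perp_M c_1$, $b_0\perp_M c_0$, $b_1\perp_M c_1$ and $b_0\equiv_M b_1$, then there is a tuple $b$ with $b\equiv_{c_0M}b_0$ and $b\equiv_{c_1M}b_1$. Then $T$ is $\mathrm{NSOP}_1$; that is, there are no formula $\varphi(x;y)$ of $L$ (with $x$, $y$ finite tuples of variables) and tuples $(a_\eta)_{\eta\in 2^{<\omega}}$ in a model of $T$ such that - for every $\eta\in 2^\omega$ the set $\{\varphi(x;a_{\eta|n}) : n<\omega\}$ is consistent (finitely satisfiable in that model), and - whenever $\eta,\nu\in 2^{<\omega}$ and $\eta\frown 0\trianglelefteq\nu$ (initial segment), the set $\{\varphi(x;a_{\eta\frown 1}),\varphi(x;a_\nu)\}$ is inconsistent. -/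

import Mathlib

open FirstOrder FirstOrder.Language Cardinal

universe u v w

namespace FirstOrder.Language

/-! ### The property SOP₁ of a theory -/

section SOP1

variable {L : Language.{u, v}}

/-- The partitioned formula `φ(x; y)` (with `|x| = k`, `|y| = m`) exemplifies SOP₁ in the structure
`N`: there is a tree of parameters `(a_η)`, `η ∈ 2^{<ω}`, such that
* for every branch `η ∈ 2^ω`, the set `{φ(x; a_{η|i}) : i < ω}` is consistent, that is, each of its
  finite subsets is realized in `N`;
* if `η⌢0 ⊴ ν`, then `{φ(x; a_{η⌢1}), φ(x; a_ν)}` is inconsistent.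

Finite binary sequences are lists of Booleans (`0 = false`, `1 = true`), `⊴` is the relation of being
an initial segment, and `η|i` is the list of the first `i` values of `η`. -/
def ExemplifiesSOP1 {k m : ℕ} (φ : L.Formula (Fin k ⊕ Fin m)) (N : Type w) [L.Structure N] : Prop :=
  ∃ a : List Bool → Fin m → N,
    (∀ (η : ℕ → Bool) (s : Finset ℕ), ∃ x : Fin k → N, ∀ i ∈ s,
      φ.Realize (Sum.elim x (a (List.ofFn fun j : Fin i => η j)))) ∧
    (∀ η ν : List Bool, (η ++ [false]) <+: ν →
      ¬ ∃ x : Fin k → N,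
        φ.Realize (Sum.elim x (a (η ++ [true]))) ∧ φ.Realize (Sum.elim x (a ν)))

/-- The theory `T` has SOP₁: some formula exemplifies SOP₁ with parameters from some model of `T`. -/
def Theory.HasSOP1 (T : L.Theory) : Prop :=
  ∃ (k m : ℕ) (φ : L.Formula (Fin k ⊕ Fin m)) (N : Theory.ModelType.{u, v, max u v} T),
    ExemplifiesSOP1 φ N

/-- The theory `T` is NSOP₁. -/
def Theory.IsNSOP1 (T : L.Theory) : Prop :=
  ¬ T.HasSOP1

end SOP1

/-! ### Types, saturation, homogeneity and monster models -/

section Monster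

variable (L : Language.{u, v}) {M : Type w} [L.Structure M]

/-- `a ≡_C b`: the tuples `a` and `b` (indexed by `I`) have the same complete type over `C`. -/
def SameTypeOver (C : Set M) {I : Type*} (a b : I → M) : Prop :=
  ∀ φ : L.Formula (C ⊕ I),
    φ.Realize (Sum.elim ((↑) : C → M) a) ↔ φ.Realize (Sum.elim ((↑) : C → M) b)

variable (M)

/-- `M` is `κ`-saturated: every type in finitely many variables over a set of fewer than `κ`
parameters, given as a finitely satisfiable set of formulas, is realized in `M`. -/
def IsSaturated (κ : Cardinal.{w}) : Prop :=
  ∀ A : Set M, #A < κ → ∀ (n : ℕ) (p : Set (L.Formula (A ⊕ Fin n))),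
    (∀ s : Finset (L.Formula (A ⊕ Fin n)), (s : Set (L.Formula (A ⊕ Fin n))) ⊆ p →
      ∃ x : Fin n → M, ∀ ψ ∈ s, ψ.Realize (Sum.elim ((↑) : A → M) x)) →
    ∃ x : Fin n → M, ∀ ψ ∈ p, ψ.Realize (Sum.elim ((↑) : A → M) x)

/-- `M` is strongly `κ`-homogeneous: every partial elementary map defined on a set of fewer than `κ`
elements of `M` extends to an automorphism of `M`. -/
def IsStronglyHomogeneous (κ : Cardinal.{w}) : Prop :=
  ∀ A : Set M, #A < κ → ∀ f : A → M,
    (∀ φ : L.Formula A, φ.Realize ((↑) : A → M) ↔ φ.Realize f) →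
    ∃ σ : M ≃[L] M, ∀ a : A, σ a = f a

/-- `M` is a monster model with smallness bound `κ`: `κ > |L| + ℵ₀`, and `M` is `κ`-saturated and
strongly `κ`-homogeneous. A subset of `M` is small if it has fewer than `κ` elements. -/
structure IsMonster (κ : Cardinal.{w}) : Prop where
  card_lt : Cardinal.lift.{w} (max ℵ₀ L.card) < Cardinal.lift.{max u v} κ
  saturated : IsSaturated L M κ
  homogeneous : IsStronglyHomogeneous L M κ

end Monster

/-! ### Properties of independence relations

A ternary relation on the small subsets of `𝕄` is given as `Ind : Set 𝕄 → Set 𝕄 → Set 𝕄 → Prop`,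
where `Ind A C B` is read `A ⫝_C B`; no property below refers to its values on sets that are not
small. Tuples enter the relation through the set of their coordinates. "Model" always means a small
elementary substructure of `𝕄`. -/

section Independence

variable (L : Language.{u, v}) {𝕄 : Type w} [L.Structure 𝕄] (κ : Cardinal.{w})
  (Ind : Set 𝕄 → Set 𝕄 → Set 𝕄 → Prop)

/-- Invariance under all automorphisms of `𝕄`. -/
def IsAutInvariant : Prop :=
  ∀ (σ : 𝕄 ≃[L] 𝕄) (A B C : Set 𝕄), #A < κ → #B < κ → #C < κ →
    (Ind A C B ↔ Ind (σ '' A) (σ '' C) (σ '' B))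

/-- Strong finite character over models: if `a` is not independent from `b` over `M`, then there is a
formula `φ(x, b, m) ∈ tp(a/bM)` such that no `a'` satisfying it is independent from `b` over `M`. -/
def StrongFiniteCharacterOverModels : Prop :=
  ∀ M : L.ElementarySubstructure 𝕄, #M < κ → ∀ (n k : ℕ) (a : Fin n → 𝕄) (b : Fin k → 𝕄),
    ¬ Ind (Set.range a) M (Set.range b) →
    ∃ φ : L.Formula (M ⊕ (Fin k ⊕ Fin n)),
      φ.Realize (Sum.elim ((↑) : M → 𝕄) (Sum.elim b a)) ∧
      ∀ a' : Fin n → 𝕄, φ.Realize (Sum.elim ((↑) : M → 𝕄) (Sum.elim b a')) →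
        ¬ Ind (Set.range a') M (Set.range b)

/-- Existence over models: `a ⫝_M M`. -/
def ExistenceOverModels : Prop :=
  ∀ M : L.ElementarySubstructure 𝕄, #M < κ → ∀ (n : ℕ) (a : Fin n → 𝕄),
    Ind (Set.range a) M M

/-- Monotonicity over models: `a a' ⫝_M B B'` implies `a ⫝_M B`. The right-hand side has to be
allowed to be infinite, as it is in `a ⫝_M M`. -/
def MonotonicityOverModels : Prop :=
  ∀ M : L.ElementarySubstructure 𝕄, #M < κ → ∀ (n n' : ℕ) (a : Fin n → 𝕄) (a' : Fin n' → 𝕄)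
    (B B' : Set 𝕄), #B < κ → #B' < κ →
    Ind (Set.range a ∪ Set.range a') M (B ∪ B') → Ind (Set.range a) M B

/-- Symmetry over models: `a ⫝_M b` if and only if `b ⫝_M a`. -/
def SymmetryOverModels : Prop :=
  ∀ M : L.ElementarySubstructure 𝕄, #M < κ → ∀ (n k : ℕ) (a : Fin n → 𝕄) (b : Fin k → 𝕄),
    Ind (Set.range a) M (Set.range b) ↔ Ind (Set.range b) M (Set.range a)

/-- Independent amalgamation over models: if `c₀ ⫝_M c₁`, `b₀ ⫝_M c₀`, `b₁ ⫝_M c₁` and `b₀ ≡_M b₁`,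
then there is `b` with `b ≡_{c₀M} b₀` and `b ≡_{c₁M} b₁`. -/
def IndependentAmalgamationOverModels : Prop :=
  ∀ M : L.ElementarySubstructure 𝕄, #M < κ → ∀ (n k₀ k₁ : ℕ) (b₀ b₁ : Fin n → 𝕄)
    (c₀ : Fin k₀ → 𝕄) (c₁ : Fin k₁ → 𝕄),
    Ind (Set.range c₀) M (Set.range c₁) →
    Ind (Set.range b₀) M (Set.range c₀) →
    Ind (Set.range b₁) M (Set.range c₁) →
    SameTypeOver L (M : Set 𝕄) b₀ b₁ →
    ∃ b : Fin n → 𝕄,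
      SameTypeOver L (Set.range c₀ ∪ (M : Set 𝕄)) b b₀ ∧
      SameTypeOver L (Set.range c₁ ∪ (M : Set 𝕄)) b b₁

end Independence

end FirstOrder.Language

/-! Suppose `φ` has SOP₁. By completeness an SOP₁ tree for `φ` exists in the monster. Limits along
the nodes 0ⁿ1 (`IsSOP1TreeAbove.exists_extension`, iterated in `exists_array`) turn it into
sequences c₀, c₁: the instances of `φ` are consistent along c₀, pairwise inconsistent along c₁, and
the n-th terms have the same type over the Skolem hull of the earlier terms. Let M be the hull of
all the terms. Along a nonprincipal ultrafilter, c₀ and c₁ then have the same limit type p over M.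

A limit over Mb of tuples from M is independent from b over M (`ind_of_realizesLimitType`):
otherwise strong finite character gives a formula that excludes independence from b but holds of
some tuple in M, whereas tuples in M are independent from b by existence, monotonicity and symmetry.

Limits along c₀ give b and d with d realizing p, φ(b; d), and b independent from d over M. Limits
along c₁ give independent realizations e₀, e₁ of p such that φ(x; e₀) and φ(x; e₁) are
contradictory. Moving b by automorphisms over M taking d to e₀ and to e₁, then amalgamating, yields
a common solution (`IsMonster.false_of_array`). -/

namespace FirstOrder.Language

open Filter

/-! ### Consistency of finitely many instances as a first-order condition. -/

section Finitary

variable {L : Language.{u, v}}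

/-- A formula can be rewritten along any reindexing of variables covering its free variables. -/
theorem Formula.exists_realize_comp_iff {α β : Type*} [DecidableEq β] {N : Type*}
    [L.Structure N] (ψ : L.Formula β) (g : α → β) (hg : ∀ b ∈ ψ.freeVarFinset, b ∈ Set.range g) :
    ∃ ψ' : L.Formula α, ∀ x : β → N,
      ψ'.Realize (x ∘ g) ↔ ψ.Realize x := by
  choose f hf using fun b : ψ.freeVarFinset => hg b b.2
  exact ⟨ψ.restrictFreeVar f, fun x =>
    BoundedFormula.realize_restrictFreeVar x fun b => congrArg x (hf b)⟩

/-- The set of instances `φ(x; c)`, for `c` in the list `l`, is realized in `N`. -/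
def InstancesRealized {k m : ℕ} {N : Type w} [L.Structure N] (φ : L.Formula (Fin k ⊕ Fin m))
    (l : List (Fin m → N)) : Prop :=
  ∃ x : Fin k → N, ∀ c ∈ l, φ.Realize (Sum.elim x c)

theorem InstancesRealized.mono {k m : ℕ} {N : Type w} [L.Structure N]
    {φ : L.Formula (Fin k ⊕ Fin m)} {l l' : List (Fin m → N)} (h : InstancesRealized φ l)
    (hl : ∀ c ∈ l', c ∈ l) : InstancesRealized φ l' :=
  h.imp fun _ hx c hc => hx c (hl c hc)

/-- The formula expressing that the instances of `φ` given by a list of tuples of variables are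
realized. -/
noncomputable def instancesFormula {k m : ℕ} (φ : L.Formula (Fin k ⊕ Fin m)) {β : Type*}
    (t : List (Fin m → β)) : L.Formula β :=
  Formula.iExs (Fin k) (Formula.iInf fun i : Fin t.length =>
    φ.relabel (Sum.elim Sum.inr fun j => Sum.inl (t.get i j)))

theorem realize_instancesFormula {k m : ℕ} {φ : L.Formula (Fin k ⊕ Fin m)} {β : Type*}
    {t : List (Fin m → β)} {N : Type w} [L.Structure N] {y : β → N} :
    (instancesFormula φ t).Realize y ↔ InstancesRealized φ (t.map (y ∘ ·)) := by
  rw [instancesFormula, Formula.realize_iExs]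
  refine exists_congr fun x => ?_
  rw [Formula.realize_iInf]
  simp only [Formula.realize_relabel, List.forall_mem_map]
  rw [List.forall_mem_iff_get]
  refine forall_congr' fun i => iff_of_eq (congrArg _ ?_)
  ext (j | j) <;> rfl

end Finitary

/-! ### Realizing ultrafilter limits of types in saturated structures. -/

section Limits

variable (L : Language.{u, v}) {M : Type w} [L.Structure M]

/-- The tuple `d` realizes the limit along `U` of the types of the tuples `x i` over `A`. -/
def RealizesLimitType (A : Set M) {I J : Type*} (U : Ultrafilter I) (x : I → J → M)
    (d : J → M) : Prop :=
  ∀ ψ : L.Formula (A ⊕ J),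
    ψ.Realize (Sum.elim (↑) d) ↔ ∀ᶠ i in U, ψ.Realize (Sum.elim (↑) (x i))

variable {L}

theorem RealizesLimitType.realize_comp {A : Set M} {I J β : Type*} {U : Ultrafilter I}
    {x : I → J → M} {d : J → M} (h : RealizesLimitType L A U x d) (ψ : L.Formula β)
    (t : β → A ⊕ J) :
    ψ.Realize (Sum.elim (↑) d ∘ t) ↔ ∀ᶠ i in U, ψ.Realize (Sum.elim (↑) (x i) ∘ t) := by
  simpa only [Formula.realize_relabel] using h (ψ.relabel t)

theorem RealizesLimitType.instancesRealized {A : Set M} {I J : Type*} {U : Ultrafilter I}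
    {x : I → J → M} {d : J → M} (h : RealizesLimitType L A U x d) {k m : ℕ}
    (φ : L.Formula (Fin k ⊕ Fin m)) (t : List (Fin m → A ⊕ J)) :
    InstancesRealized φ (t.map (Sum.elim (↑) d ∘ ·)) ↔
      ∀ᶠ i in U, InstancesRealized φ (t.map (Sum.elim (↑) (x i) ∘ ·)) := by
  simpa only [realize_instancesFormula] using h (instancesFormula φ t)

/-- One step of realizing a limit type coordinate by coordinate. -/
theorem IsSaturated.exists_limit_step {κ : Cardinal.{w}} (hM : IsSaturated L M κ)
    (hκ : ℵ₀ ≤ κ) {A : Set M} (hA : #A < κ) {I : Type*} (U : Ultrafilter I) (x : I → ℕ → M) (n : ℕ)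
    (d : Fin n → M) (hd : RealizesLimitType L A U (fun i j => x i (j : Fin n)) d) :
    ∃ e : M, RealizesLimitType L A U (fun i j => x i (j : Fin (n + 1))) (Fin.snoc d e) := by
  classical
  set A' : Set M := A ∪ Set.range d
  have hA' : #A' < κ := (mk_union_le _ _).trans_lt
    (add_lt_of_lt hκ hA ((mk_lt_aleph0_iff.2 inferInstance).trans_le hκ))
  let t : A ⊕ Fin (n + 1) → A' ⊕ Fin 1 := Sum.elim (fun a => Sum.inl ⟨a, Or.inl a.2⟩)
    (Fin.lastCases (Sum.inr 0) fun j => Sum.inl ⟨d j, Or.inr ⟨j, rfl⟩⟩)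
  have ht : ∀ e : Fin 1 → M, Sum.elim ((↑) : A' → M) e ∘ t =
      Sum.elim (↑) (Fin.snoc d (e 0) : Fin (n + 1) → M) := by
    intro e
    ext (a | j)
    · rfl
    · refine Fin.lastCases ?_ (fun j => ?_) j <;> simp [t]
  let P : Set (L.Formula (A ⊕ Fin (n + 1))) :=
    {ψ | ∀ᶠ i in U, ψ.Realize (Sum.elim (↑) fun j : Fin (n + 1) => x i j)}
  obtain ⟨e, he⟩ := hM A' hA' 1 ((fun ψ => ψ.relabel t) '' P) fun s hs => by
    obtain ⟨s', hs', rfl⟩ := Finset.subset_set_image_iff.1 hs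
    -- `χ` says that the finitely many formulas have a common solution in the last coordinate. It
    -- mentions only the first `n` coordinates, so it passes from `U`-almost all `x i` to `d`.
    let χ : L.Formula (A ⊕ Fin n) := Formula.iExs (Fin 1) (Formula.iInf fun ψ : s' =>
      ψ.1.relabel (Sum.elim (Sum.inl ∘ Sum.inl)
        (Fin.lastCases (Sum.inr 0) fun j => Sum.inl (Sum.inr j))))
    have hχ : ∀ y : Fin n → M, χ.Realize (Sum.elim (↑) y) ↔
        ∃ e : Fin 1 → M, ∀ ψ ∈ s',
          ψ.Realize (Sum.elim (↑) (Fin.snoc y (e 0) : Fin (n + 1) → M)) := by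
      intro y
      simp only [χ, Formula.realize_iExs, Formula.realize_iInf, Formula.realize_relabel,
        Subtype.forall]
      refine exists_congr fun e => forall₂_congr fun ψ _ => iff_of_eq (congrArg _ ?_)
      ext (a | j)
      · rfl
      · refine Fin.lastCases ?_ (fun j => ?_) j <;> simp
    have hall : ∀ᶠ i in U, ∀ ψ ∈ s', ψ.Realize (Sum.elim (↑) fun j : Fin (n + 1) => x i j) :=
      (Filter.eventually_all_finset s').2 fun ψ hψ => hs' hψ
    obtain ⟨e, he⟩ := (hχ d).1 ((hd χ).2 (hall.mono fun i hi => (hχ _).2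
      ⟨fun _ => x i n, fun ψ hψ => by
        convert hi ψ hψ using 2
        ext j
        refine Fin.lastCases ?_ (fun j => ?_) j <;> simp⟩))
    refine ⟨e, fun ψ' hψ' => ?_⟩
    obtain ⟨ψ, hψ, rfl⟩ := Finset.mem_image.1 hψ'
    rw [Formula.realize_relabel, ht]
    exact he ψ hψ
  have key : ∀ ψ ∈ P, ψ.Realize (Sum.elim (↑) (Fin.snoc d (e 0) : Fin (n + 1) → M)) := by
    intro ψ hψ
    simpa only [Formula.realize_relabel, ht] using he _ ⟨ψ, hψ, rfl⟩
  refine ⟨e 0, fun ψ => ⟨fun h => ?_, key ψ⟩⟩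
  by_contra hn
  refine Formula.realize_not.1 (key ψ.not ?_) h
  simpa only [P, Set.mem_ofPred_eq, Formula.realize_not] using Ultrafilter.eventually_not.2 hn

/-- Saturation covers only finitely many variables, so the coordinates are chosen successively, each
extending the previous choices. This suffices because a formula mentions only finitely many
coordinates. -/
theorem IsSaturated.exists_realizesLimitType_nat {κ : Cardinal.{w}} (hM : IsSaturated L M κ)
    (hκ : ℵ₀ ≤ κ) {A : Set M} (hA : #A < κ) {I : Type*} (U : Ultrafilter I) (x : I → ℕ → M) :
    ∃ d : ℕ → M, RealizesLimitType L A U x d := by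
  classical
  let D : (n : ℕ) → {d : Fin n → M // RealizesLimitType L A U (fun i j => x i (j : Fin n)) d} :=
    fun n => Nat.rec ⟨Fin.elim0, fun ψ => by
        have e : ∀ i, (fun j : Fin 0 => x i j) = Fin.elim0 := fun i => Subsingleton.elim _ _
        simp only [e, Filter.eventually_const]⟩
      (fun n d => ⟨Fin.snoc d.1 (hM.exists_limit_step hκ hA U x n d.1 d.2).choose,
        (hM.exists_limit_step hκ hA U x n d.1 d.2).choose_spec⟩) n
  have hDs : ∀ n (j : Fin n), (D (n + 1)).1 j.castSucc = (D n).1 j := fun n j =>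
    Fin.snoc_castSucc (α := fun _ => M) _ _ _
  let d : ℕ → M := fun n => (D (n + 1)).1 (Fin.last n)
  have hd : ∀ n (j : Fin n), d j = (D n).1 j := by
    intro n
    induction n with
    | zero => exact fun j => j.elim0
    | succ n ih =>
      refine Fin.lastCases rfl fun j => ?_
      rw [hDs, ← ih j]
      rfl
  refine ⟨d, fun ψ => ?_⟩
  obtain ⟨n, hn⟩ : ∃ n, ∀ j, Sum.inr j ∈ ψ.freeVarFinset → j < n := by
    obtain ⟨n, hn⟩ := (ψ.freeVarFinset.preimage Sum.inr Sum.inr_injective.injOn).exists_nat_subset_range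
    exact ⟨n, fun j hj => Finset.mem_range.1 (hn (Finset.mem_preimage.2 hj))⟩
  obtain ⟨ψ', hψ'⟩ := ψ.exists_realize_comp_iff (N := M)
    (Sum.map id Fin.val : A ⊕ Fin n → A ⊕ ℕ) (by
      rintro (a | j) hj
      · exact ⟨Sum.inl a, rfl⟩
      · exact ⟨Sum.inr ⟨j, hn j hj⟩, rfl⟩)
  have h := (D n).2 ψ'
  have e1 : ∀ y : ℕ → M, Sum.elim ((↑) : A → M) (fun j : Fin n => y j) =
      Sum.elim (↑) y ∘ Sum.map id Fin.val := fun y => by ext (a | j) <;> rfl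
  rw [← funext (hd n)] at h
  simpa only [e1, hψ'] using h

/-- In a `κ`-saturated structure with `κ` uncountable, limits along an ultrafilter of types of
countable tuples over small sets are realized. -/
theorem IsSaturated.exists_realizesLimitType {κ : Cardinal.{w}} (hM : IsSaturated L M κ)
    (hκ : ℵ₀ ≤ κ) {A : Set M} (hA : #A < κ) {I J : Type*} [Countable J] [Nonempty M]
    (U : Ultrafilter I) (x : I → J → M) :
    ∃ d : J → M, RealizesLimitType L A U x d := by
  obtain ⟨h, hh⟩ := Countable.exists_injective_nat J
  obtain ⟨d, hd⟩ := hM.exists_realizesLimitType_nat hκ hA U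
    fun i => Function.extend h (x i) fun _ => Classical.arbitrary M
  refine ⟨d ∘ h, fun ψ => ?_⟩
  have e : ∀ y : ℕ → M, Sum.elim ((↑) : A → M) y ∘ Sum.map id h = Sum.elim (↑) (y ∘ h) :=
    fun y => by ext (a | j) <;> rfl
  have := hd.realize_comp ψ (Sum.map id h)
  simpa only [e, Function.extend_comp hh] using this

/-- A countable tuple from a model of a complete theory has a copy in every saturated model. -/
theorem IsSaturated.exists_realize_iff_of_isComplete {κ : Cardinal.{w}} (hM : IsSaturated L M κ)
    (hκ : ℵ₀ ≤ κ) [Nonempty M] {T : L.Theory} (hT : T.IsComplete) [M ⊨ T] {N : Type*}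
    [L.Structure N] [Nonempty N] [N ⊨ T] {J : Type*} [Countable J] (a : J → N) :
    ∃ d : J → M, ∀ ψ : L.Formula J, ψ.Realize a ↔ ψ.Realize d := by
  classical
  have hfin : ∀ ψ : L.Formula J, ψ.Realize a → ∃ y : J → M, ψ.Realize y := by
    intro ψ hψ
    have hN : N ⊨ ψ.exClosure := (Formula.realize_exClosure _).2 ⟨a ∘ Subtype.val,
      (BoundedFormula.realize_restrictFreeVar (f := id) (v := a ∘ Subtype.val) a fun _ => rfl).2 hψ⟩
    obtain ⟨y, hy⟩ := (Formula.realize_exClosure _).1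
      ((hT.realize_sentence_iff _ M).2 ((hT.realize_sentence_iff _ N).1 hN))
    let y' : J → M := fun j => if h : j ∈ ψ.freeVarFinset then y ⟨j, h⟩ else Classical.arbitrary M
    exact ⟨y', (BoundedFormula.realize_restrictFreeVar y' fun j => by simp [y']).1 hy⟩
  let Γ := {ψ : L.Formula J // ψ.Realize a}
  have hΓ : ∀ s : Finset Γ, ∃ y : J → M, ∀ ψ ∈ s, ψ.1.Realize y := by
    intro s
    obtain ⟨y, hy⟩ := hfin (Formula.iInf fun ψ : s => ψ.1.1)
      (Formula.realize_iInf.2 fun ψ => ψ.1.2)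
    exact ⟨y, fun ψ hψ => Formula.realize_iInf.1 hy ⟨ψ, hψ⟩⟩
  choose y hy using hΓ
  -- The finite subsets of the type of `a` are directed by inclusion; along an ultrafilter refining
  -- this order, each formula of the type eventually holds, hence holds in the limit.
  obtain ⟨d, hd⟩ := hM.exists_realizesLimitType hκ (A := ∅)
    (by simpa using (aleph0_pos.trans_le hκ)) (Ultrafilter.of atTop) y
  have key : ∀ ψ : L.Formula J, ψ.Realize a → ψ.Realize d := fun ψ hψ =>
    (hd.realize_comp ψ Sum.inr).2 (Ultrafilter.of_le _
      ((eventually_ge_atTop {⟨ψ, hψ⟩}).mono fun s hs =>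
        hy s ⟨ψ, hψ⟩ (hs (Finset.mem_singleton_self _))))
  refine ⟨d, fun ψ => ⟨key ψ, fun h => ?_⟩⟩
  by_contra hn
  exact Formula.realize_not.1 (key ψ.not (Formula.realize_not.2 hn)) h

end Limits

end FirstOrder.Language

namespace FirstOrder.Language

open Filter

/-! ### From an SOP₁ tree to two parallel sequences. -/

section Trees

variable {L : Language.{u, v}} {M : Type w} [L.Structure M] {k m : ℕ}

/-- An SOP₁ tree for `φ` extending a finite history: the instances of `φ` at the tuples in `l₀`
remain consistent with every branch, those at the tuples in `l₁` contradict every node. -/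
structure IsSOP1TreeAbove (φ : L.Formula (Fin k ⊕ Fin m)) (l₀ l₁ : List (Fin m → M))
    (a : List Bool → Fin m → M) : Prop where
  branch : ∀ η : List Bool, InstancesRealized φ (l₀ ++ η.inits.map a)
  incompatible : ∀ η ν : List Bool, (η ++ [false]) <+: ν →
    ¬ InstancesRealized φ [a (η ++ [true]), a ν]
  above : ∀ c ∈ l₁, ∀ η, ¬ InstancesRealized φ [c, a η]

theorem ExemplifiesSOP1.exists_isSOP1TreeAbove {φ : L.Formula (Fin k ⊕ Fin m)} {N : Type w}
    [L.Structure N] (h : ExemplifiesSOP1 φ N) :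
    ∃ a : List Bool → Fin m → N, IsSOP1TreeAbove φ [] [] a := by
  obtain ⟨a, hbr, hinc⟩ := h
  refine ⟨a, fun η => ?_, fun η ν hη ⟨x, hx⟩ => hinc η ν hη ⟨x, ?_⟩, by simp⟩
  -- The finite sequence is prolonged by zeros to a branch; the `+ 1` keeps the node `η` itself
  -- among its initial segments.
  · obtain ⟨x, hx⟩ := hbr (fun i => η.getD i false) (Finset.range (η.length + 1))
    refine ⟨x, fun c hc => ?_⟩
    obtain ⟨ρ, hρ, rfl⟩ := List.mem_map.1 (List.mem_append.1 hc |>.resolve_left List.not_mem_nil)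
    have hρη : ρ <+: η := (List.mem_inits _ _).1 hρ
    have := hx ρ.length (Finset.mem_range.2 (Nat.lt_succ_of_le hρη.length_le))
    convert this using 3
    refine List.ext_getElem (by simp) fun i h₁ h₂ => ?_
    have h₃ : i < η.length := h₁.trans_le hρη.length_le
    simp [hρη.getElem h₁, h₃]
  · exact ⟨hx _ (by simp), hx _ (by simp)⟩

/-- Each tree condition concerns the consistency of a finite list of instances, so it belongs to the
type of the countable tuple of all nodes. -/
theorem IsSOP1TreeAbove.exists_of_isComplete {φ : L.Formula (Fin k ⊕ Fin m)} {κ : Cardinal.{w}}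
    (hM : IsSaturated L M κ) (hκ : ℵ₀ ≤ κ) [Nonempty M] {T : L.Theory} (hT : T.IsComplete) [M ⊨ T]
    {N : Type*} [L.Structure N] [Nonempty N] [N ⊨ T] {a : List Bool → Fin m → N}
    (ha : IsSOP1TreeAbove φ [] [] a) :
    ∃ a' : List Bool → Fin m → M, IsSOP1TreeAbove φ [] [] a' := by
  obtain ⟨d, hd⟩ := hM.exists_realize_iff_of_isComplete hκ hT
    fun p : List Bool × Fin m => a p.1 p.2
  have key : ∀ l : List (List Bool), InstancesRealized φ (l.map a) ↔
      InstancesRealized φ (l.map fun η j => d (η, j)) := by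
    intro l
    have := hd (instancesFormula φ (l.map fun η j => (η, j)))
    simp only [realize_instancesFormula, List.map_map] at this
    exact this
  exact ⟨fun η j => d (η, j), fun η => (key _).1 (ha.branch η),
    fun η ν hη h => ha.incompatible η ν hη ((key [η ++ [true], ν]).2 h), by simp⟩

/-- Two nodes with the same type over a small set can be added to the history of an SOP₁ tree, one
on the consistent side and one on the inconsistent side. -/
theorem IsSOP1TreeAbove.exists_extension {φ : L.Formula (Fin k ⊕ Fin m)} {κ : Cardinal.{w}}
    (hM : IsSaturated L M κ) (hκ : ℵ₀ ≤ κ) [Nonempty M] {l₀ l₁ : List (Fin m → M)}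
    {a : List Bool → Fin m → M} (ha : IsSOP1TreeAbove φ l₀ l₁ a) {A : Set M} (hA : #A < κ)
    (h₀ : ∀ c ∈ l₀, ∀ j, c j ∈ A) (h₁ : ∀ c ∈ l₁, ∀ j, c j ∈ A) :
    ∃ (c₀ c₁ : Fin m → M) (a' : List Bool → Fin m → M),
      IsSOP1TreeAbove φ (c₀ :: l₀) (c₁ :: l₁) a' ∧ SameTypeOver L A c₀ c₁ ∧
      ∀ c ∈ l₁, ¬ InstancesRealized φ [c, c₁] := by
  let U : Ultrafilter ℕ := hyperfilter ℕ
  -- For the iterated ultrafilter, almost every pair is strictly increasing, yet each coordinate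
  -- taken alone is distributed as `U`. Hence both nodes of the pair have the same limit type.
  let V : Ultrafilter (ℕ × ℕ) := U.bind fun n => U.map (Prod.mk n)
  have hV : ∀ P : ℕ × ℕ → Prop, (∀ᶠ p in V, P p) ↔ ∀ᶠ n in U, ∀ᶠ n' in U, P (n, n') :=
    fun P => Iff.rfl
  have hVlt : ∀ᶠ p : ℕ × ℕ in V, p.1 < p.2 := (hV _).2 (Eventually.of_forall fun n =>
    (eventually_gt_atTop n).filter_mono Nat.hyperfilter_le_atTop)
  let node : ℕ → List Bool := fun n => List.replicate n false ++ [true]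
  let x : ℕ × ℕ → (Fin m ⊕ Fin m) ⊕ (List Bool × Fin m) → M := fun p =>
    Sum.elim (Sum.elim (a (node p.1)) (a (node p.2))) fun q => a (node p.2 ++ q.1) q.2
  obtain ⟨d, hd⟩ := hM.exists_realizesLimitType hκ hA V x
  let y₁ : Fin m → A ⊕ ((Fin m ⊕ Fin m) ⊕ (List Bool × Fin m)) := fun j => .inr (.inl (.inl j))
  let y₀ : Fin m → A ⊕ ((Fin m ⊕ Fin m) ⊕ (List Bool × Fin m)) := fun j => .inr (.inl (.inr j))
  let z : List Bool → Fin m → A ⊕ ((Fin m ⊕ Fin m) ⊕ (List Bool × Fin m)) :=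
    fun η j => .inr (.inr (η, j))
  have hlift : ∀ c : Fin m → M, (∀ j, c j ∈ A) →
      ∃ t : Fin m → A ⊕ ((Fin m ⊕ Fin m) ⊕ (List Bool × Fin m)),
        ∀ y, Sum.elim ((↑) : A → M) y ∘ t = c := fun c hc =>
    ⟨fun j => .inl ⟨c j, hc j⟩, fun _ => rfl⟩
  have hlift₀ : ∃ t : List (Fin m → A ⊕ ((Fin m ⊕ Fin m) ⊕ (List Bool × Fin m))),
      ∀ y, t.map (Sum.elim ((↑) : A → M) y ∘ ·) = l₀ := by
    clear ha
    induction l₀ with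
    | nil => exact ⟨[], fun _ => rfl⟩
    | cons c l ih =>
      obtain ⟨t, ht⟩ := ih fun c hc => h₀ c (List.mem_cons_of_mem _ hc)
      obtain ⟨s, hs⟩ := hlift c (h₀ c List.mem_cons_self)
      exact ⟨s :: t, fun y => by simp [hs y, ht y]⟩
  obtain ⟨t₀, ht₀⟩ := hlift₀
  -- The later node 0ⁿ'1 goes to the consistent side, as the new tree sits above it. The earlier
  -- node 0ⁿ1 contradicts that whole tree, which lies above 0ⁿ0.
  refine ⟨fun j => d (.inl (.inr j)), fun j => d (.inl (.inl j)), fun η j => d (.inr (η, j)),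
    ⟨fun η => ?_, fun η ν hη => ?_, fun c hc η => ?_⟩, fun ψ => ?_, fun c hc => ?_⟩
  · have := (hd.instancesRealized φ (y₀ :: (t₀ ++ η.inits.map z))).2
      (Eventually.of_forall fun p => by
        simp only [List.map_cons, List.map_append, ht₀]
        refine (ha.branch (node p.2 ++ η)).mono fun c hc => ?_
        simp only [List.map_map, List.mem_cons, List.mem_append, List.mem_map, List.mem_inits]
          at hc ⊢
        obtain rfl | hc | ⟨ρ, hρ, rfl⟩ := hc
        · exact Or.inr ⟨node p.2, List.prefix_append _ _, rfl⟩
        · exact Or.inl hc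
        · exact Or.inr ⟨node p.2 ++ ρ, (List.prefix_append_right_inj _).2 hρ, rfl⟩)
    simp only [List.map_cons, List.map_append, ht₀, List.map_map] at this
    exact this
  · refine (hd.instancesRealized φ [z (η ++ [true]), z ν]).not.2 (Ultrafilter.eventually_not.1
      (Eventually.of_forall fun p h => ?_))
    refine ha.incompatible (node p.2 ++ η) (node p.2 ++ ν) ?_ (h.mono ?_)
    · rw [List.append_assoc]
      exact (List.prefix_append_right_inj _).2 hη
    · rw [List.append_assoc]
      exact fun c hc => hc
  · obtain rfl | hc := List.mem_cons.1 hc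
    · refine (hd.instancesRealized φ [y₁, z η]).not.2 (Ultrafilter.eventually_not.1
        (hVlt.mono fun p hp h => ?_))
      refine ha.incompatible (List.replicate p.1 false) (node p.2 ++ η) ?_ h
      obtain ⟨r, hr⟩ := Nat.exists_eq_add_of_lt hp
      have e : p.2 = (p.1 + 1) + r := by omega
      refine List.IsPrefix.trans ?_ (List.prefix_append _ _)
      simp only [node, e, List.replicate_add, List.append_assoc]
      exact (List.prefix_append_right_inj _).2 (List.prefix_append _ _)
    · obtain ⟨t, ht⟩ := hlift c (h₁ c hc)
      have := (hd.instancesRealized φ [t, z η]).not.2 (Ultrafilter.eventually_not.1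
        (Eventually.of_forall fun p h => ha.above c hc (node p.2 ++ η) (by
          simp only [List.map_cons, ht] at h
          exact h)))
      simp only [List.map_cons, ht] at this
      exact this
  · have e₀ : ∀ y : (Fin m ⊕ Fin m) ⊕ (List Bool × Fin m) → M,
        Sum.elim ((↑) : A → M) y ∘ Sum.elim .inl y₀ = Sum.elim (↑) fun j => y (.inl (.inr j)) :=
      fun y => by ext (a | j) <;> rfl
    have e₁ : ∀ y : (Fin m ⊕ Fin m) ⊕ (List Bool × Fin m) → M,
        Sum.elim ((↑) : A → M) y ∘ Sum.elim .inl y₁ = Sum.elim (↑) fun j => y (.inl (.inl j)) :=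
      fun y => by ext (a | j) <;> rfl
    have k₀ := hd.realize_comp ψ (Sum.elim .inl y₀)
    have k₁ := hd.realize_comp ψ (Sum.elim .inl y₁)
    rw [hV] at k₀ k₁
    simp only [e₀, e₁] at k₀ k₁
    rw [k₀, k₁]
    simp only [x, Sum.elim_inl, Sum.elim_inr, Filter.eventually_const]
  · obtain ⟨t, ht⟩ := hlift c (h₁ c hc)
    have := (hd.instancesRealized φ [t, y₁]).not.2 (Ultrafilter.eventually_not.1
      (Eventually.of_forall fun p h => ha.above c hc (node p.1) (by
        simp only [List.map_cons, ht] at h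
        exact h)))
    simp only [List.map_cons, ht] at this
    exact this

/-- An SOP₁ tree yields two sequences, one on which `φ` is consistent and one on which it is
pairwise inconsistent, whose `i`-th terms have the same type over `cl` of the previous terms. -/
theorem IsSOP1TreeAbove.exists_array {φ : L.Formula (Fin k ⊕ Fin m)} {κ : Cardinal.{w}}
    (hM : IsSaturated L M κ) (hκ : ℵ₀ ≤ κ) [Nonempty M] {a : List Bool → Fin m → M}
    (ha : IsSOP1TreeAbove φ [] [] a) (cl : Set M → Set M) (hcl : ∀ s, s ⊆ cl s)
    (hcard : ∀ s : Set M, s.Finite → #(cl s) < κ) :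
    ∃ c₀ c₁ : ℕ → Fin m → M,
      (∀ n, ∃ x : Fin k → M, ∀ i < n, φ.Realize (Sum.elim x (c₀ i))) ∧
      (∀ i j, i < j → ¬ InstancesRealized φ [c₁ i, c₁ j]) ∧
      ∀ n, SameTypeOver L (cl (⋃ i < n, Set.range (c₀ i) ∪ Set.range (c₁ i))) (c₀ n) (c₁ n) := by
  let S := {s : List (Fin m → M) × List (Fin m → M) × (List Bool → Fin m → M) //
    IsSOP1TreeAbove φ s.1 s.2.1 s.2.2}
  let H : S → Set M := fun s => (⋃ c ∈ {c | c ∈ s.1.1}, Set.range c) ∪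
    ⋃ c ∈ {c | c ∈ s.1.2.1}, Set.range c
  have hH : ∀ s, (H s).Finite := fun s =>
    ((List.finite_toSet s.1.1).biUnion fun c _ => Set.finite_range c).union
      ((List.finite_toSet s.1.2.1).biUnion fun c _ => Set.finite_range c)
  have step : ∀ s : S, ∃ (c₀ c₁ : Fin m → M) (s' : S), s'.1.1 = c₀ :: s.1.1 ∧
      s'.1.2.1 = c₁ :: s.1.2.1 ∧ SameTypeOver L (cl (H s)) c₀ c₁ ∧
      ∀ c ∈ s.1.2.1, ¬ InstancesRealized φ [c, c₁] := by
    intro s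
    obtain ⟨c₀, c₁, a', ha', h, h'⟩ := s.2.exists_extension hM hκ (hcard _ (hH s))
      (fun c hc j => hcl _ (Or.inl (Set.mem_biUnion hc (Set.mem_range_self j))))
      (fun c hc j => hcl _ (Or.inr (Set.mem_biUnion hc (Set.mem_range_self j))))
    exact ⟨c₀, c₁, ⟨⟨_, _, a'⟩, ha'⟩, rfl, rfl, h, h'⟩
  choose f₀ f₁ next hn₀ hn₁ htp hinc using step
  let s : ℕ → S := fun n => next^[n] ⟨⟨[], [], a⟩, ha⟩
  have hs : ∀ n, s (n + 1) = next (s n) := fun n => Function.iterate_succ_apply' next n _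
  have mem₀ : ∀ n c, c ∈ (s n).1.1 ↔ ∃ i < n, f₀ (s i) = c := by
    intro n c
    induction n with
    | zero => simp [s]
    | succ n ih =>
      rw [hs, hn₀, List.mem_cons, ih]
      simp only [Nat.lt_succ_iff_lt_or_eq, or_and_right, exists_or, exists_eq_left]
      rw [or_comm, eq_comm]
  have mem₁ : ∀ n c, c ∈ (s n).1.2.1 ↔ ∃ i < n, f₁ (s i) = c := by
    intro n c
    induction n with
    | zero => simp [s]
    | succ n ih =>
      rw [hs, hn₁, List.mem_cons, ih]
      simp only [Nat.lt_succ_iff_lt_or_eq, or_and_right, exists_or, exists_eq_left]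
      rw [or_comm, eq_comm]
  refine ⟨fun n => f₀ (s n), fun n => f₁ (s n), fun n => ?_, fun i j hij => ?_, fun n => ?_⟩
  · obtain ⟨x, hx⟩ := (s n).2.branch []
    exact ⟨x, fun i hi => hx _ (List.mem_append_left _ ((mem₀ n _).2 ⟨i, hi, rfl⟩))⟩
  · exact hinc _ _ ((mem₁ j _).2 ⟨i, hij, rfl⟩)
  · have e : H (s n) = ⋃ i < n, Set.range (f₀ (s i)) ∪ Set.range (f₁ (s i)) := by
      ext y
      simp only [H, Set.mem_union, Set.mem_iUnion, Set.mem_ofPred_eq, mem₀, mem₁, exists_prop]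
      constructor
      · rintro (⟨_, ⟨i, hi, rfl⟩, hy⟩ | ⟨_, ⟨i, hi, rfl⟩, hy⟩)
        exacts [⟨i, hi, Or.inl hy⟩, ⟨i, hi, Or.inr hy⟩]
      · rintro ⟨i, hi, hy | hy⟩
        exacts [Or.inl ⟨_, ⟨i, hi, rfl⟩, hy⟩, Or.inr ⟨_, ⟨i, hi, rfl⟩, hy⟩]
    rw [← e]
    exact htp (s n)

end Trees

end FirstOrder.Language

namespace FirstOrder.Language

open Filter

/-! ### Skolem hulls as small models. -/

section SkolemHull

variable (L : Language.{u, v}) {M : Type w} [L.Structure M] [Nonempty M]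

/-- The elementary substructure generated by `s` under Skolem functions. -/
noncomputable def skolemHull (s : Set M) : L.ElementarySubstructure M :=
  (Substructure.closure (L.sum L.skolem₁) s).elementarySkolem₁Reduct

theorem subset_skolemHull (s : Set M) : s ⊆ skolemHull L s :=
  Substructure.subset_closure (L := L.sum L.skolem₁)

theorem skolemHull_mono {s t : Set M} (h : s ⊆ t) :
    (skolemHull L s : Set M) ⊆ skolemHull L t :=
  Substructure.closure_mono (L := L.sum L.skolem₁) h

/-- There are at most |L| + ℵ₀ Skolem functions, so the hull of a countable set has at most |L| + ℵ₀
elements; this is where the full bound on `κ` matters. -/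
theorem mk_skolemHull_lt {κ : Cardinal.{w}}
    (hκ : Cardinal.lift.{w} (max ℵ₀ L.card) < Cardinal.lift.{max u v} κ)
    {s : Set M} (hs : s.Countable) : #(skolemHull L s) < κ := by
  rw [← Cardinal.lift_lt.{w, max u v}]
  refine lt_of_le_of_lt ?_ hκ
  refine (Substructure.lift_card_closure_le (L := L.sum L.skolem₁) (s := s)).trans ?_
  have h₁ : ℵ₀ ≤ Cardinal.lift.{w} (max ℵ₀ L.card) := by simp
  refine max_le h₁ (add_le_of_le h₁ ?_ (Cardinal.lift_le.2 card_functions_sum_skolem₁_le))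
  exact le_trans (by simpa using hs) h₁

theorem exists_mem_skolemHull_of_mem_iUnion {S : ℕ → Set M} (hS : Monotone S) {x : M}
    (hx : x ∈ skolemHull L (⋃ i, S i)) : ∃ i, x ∈ skolemHull L (S i) := by
  refine Substructure.closure_induction (L := L.sum L.skolem₁)
    (p := fun x => ∃ i, x ∈ skolemHull L (S i)) hx (fun y hy => ?_) (fun f y hy => ?_)
  · obtain ⟨i, hi⟩ := Set.mem_iUnion.1 hy
    exact ⟨i, subset_skolemHull L _ hi⟩
  · choose i hi using hy
    refine ⟨Finset.univ.sup i, Substructure.fun_mem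
      (Substructure.closure (L.sum L.skolem₁) (S (Finset.univ.sup i))) f y fun j => ?_⟩
    exact skolemHull_mono L (hS (Finset.le_sup (Finset.mem_univ j))) (hi j)

/-- If the `n`-th terms of two sequences have the same type over the hull of the `n`-th set of an
increasing chain, then every formula over the hull of the union eventually agrees on them. -/
theorem eventually_realize_iff_of_sameTypeOver {J : Type*} {S : ℕ → Set M} (hS : Monotone S)
    {c₀ c₁ : ℕ → J → M} (h : ∀ n, SameTypeOver L (skolemHull L (S n) : Set M) (c₀ n) (c₁ n))
    (ψ : L.Formula ((skolemHull L (⋃ i, S i) : Set M) ⊕ J)) :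
    ∀ᶠ n in atTop, (ψ.Realize (Sum.elim (↑) (c₀ n)) ↔ ψ.Realize (Sum.elim (↑) (c₁ n))) := by
  classical
  -- Only finitely many parameters occur in `ψ`, so all of them lie in the hull of a single `S n`.
  choose i hi using fun x : (skolemHull L (⋃ i, S i) : Set M) =>
    exists_mem_skolemHull_of_mem_iUnion L hS x.2
  refine (eventually_ge_atTop
    ((ψ.freeVarFinset.preimage Sum.inl Sum.inl_injective.injOn).sup i)).mono fun n hn => ?_
  let g : (skolemHull L (S n) : Set M) ⊕ J → (skolemHull L (⋃ i, S i) : Set M) ⊕ J :=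
    Sum.map (Set.inclusion (skolemHull_mono L (Set.subset_iUnion S n))) id
  obtain ⟨ψ', hψ'⟩ := ψ.exists_realize_comp_iff (N := M) g (by
    rintro (x | j) hx
    · exact ⟨.inl ⟨x, skolemHull_mono L
        (hS ((Finset.le_sup (f := i) (Finset.mem_preimage.2 hx)).trans hn)) (hi x)⟩, rfl⟩
    · exact ⟨.inr j, rfl⟩)
  have e : ∀ y : J → M, Sum.elim ((↑) : (skolemHull L (⋃ i, S i) : Set M) → M) y ∘ g =
      Sum.elim (↑) y := fun y => by ext (x | j) <;> rfl
  rw [← hψ', ← hψ', e, e]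
  exact h n ψ'

end SkolemHull

/-! ### Conjugation over small sets, and independence of limit types. -/

section Independence

variable {L : Language.{u, v}} {𝕄 : Type w} [L.Structure 𝕄] {κ : Cardinal.{w}}

theorem SameTypeOver.symm {C : Set 𝕄} {I : Type*} {a b : I → 𝕄} (h : SameTypeOver L C a b) :
    SameTypeOver L C b a := fun ψ => (h ψ).symm

theorem SameTypeOver.trans {C : Set 𝕄} {I : Type*} {a b c : I → 𝕄} (h : SameTypeOver L C a b)
    (h' : SameTypeOver L C b c) : SameTypeOver L C a c := fun ψ => (h ψ).trans (h' ψ)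

theorem sameTypeOver_of_automorphism {C : Set 𝕄} {I : Type*} (σ : 𝕄 ≃[L] 𝕄)
    (hσ : ∀ x ∈ C, σ x = x) (a : I → 𝕄) : SameTypeOver L C a (σ ∘ a) := by
  intro ψ
  have e : (σ : 𝕄 → 𝕄) ∘ Sum.elim ((↑) : C → 𝕄) a = Sum.elim (↑) (σ ∘ a) := by
    ext (x | j)
    · exact hσ x x.2
    · rfl
  rw [← e, StrongHomClass.realize_formula]

theorem IsStronglyHomogeneous.exists_automorphism (h : IsStronglyHomogeneous L 𝕄 κ)
    (hκ : ℵ₀ ≤ κ) {C : Set 𝕄} (hC : #C < κ) {n : ℕ} {d e : Fin n → 𝕄}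
    (hde : SameTypeOver L C d e) :
    ∃ σ : 𝕄 ≃[L] 𝕄, (∀ x ∈ C, σ x = x) ∧ σ ∘ d = e := by
  set A : Set 𝕄 := C ∪ Set.range d
  have hA : #A < κ := (mk_union_le _ _).trans_lt
    (add_lt_of_lt hκ hC ((mk_lt_aleph0_iff.2 inferInstance).trans_le hκ))
  have ht : ∀ a : A, ∃ t : C ⊕ Fin n, Sum.elim ((↑) : C → 𝕄) d t = a := by
    rintro ⟨a, ha | ⟨j, rfl⟩⟩
    exacts [⟨.inl ⟨a, ha⟩, rfl⟩, ⟨.inr j, rfl⟩]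
  choose t ht using ht
  obtain ⟨σ, hσ⟩ := h A hA (Sum.elim (↑) e ∘ t) fun ψ => by
    have := hde (ψ.relabel t)
    rwa [Formula.realize_relabel, Formula.realize_relabel,
      show Sum.elim ((↑) : C → 𝕄) d ∘ t = (↑) from funext ht] at this
  -- An element may have several names in `C ⊕ Fin n`; equality formulas in the common type show
  -- that its image does not depend on the name chosen by `t`.
  have key : ∀ s : C ⊕ Fin n, ∀ hs : Sum.elim ((↑) : C → 𝕄) d s ∈ A,
      Sum.elim ((↑) : C → 𝕄) e (t ⟨_, hs⟩) = Sum.elim (↑) e s := by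
    intro s hs
    have := hde (Term.equal (Term.var (t ⟨_, hs⟩)) (Term.var s))
    simp only [Formula.realize_equal, Term.realize_var] at this
    exact this.1 (ht ⟨_, hs⟩)
  refine ⟨σ, fun x hx => ?_, funext fun j => ?_⟩
  · exact (hσ ⟨x, Or.inl hx⟩).trans (key (.inl ⟨x, hx⟩) (Or.inl hx))
  · exact (hσ ⟨d j, Or.inr ⟨j, rfl⟩⟩).trans (key (.inr j) (Or.inr ⟨j, rfl⟩))

variable {Ind : Set 𝕄 → Set 𝕄 → Set 𝕄 → Prop}

/-- A tuple whose type over `M b` is a limit of types of tuples from `M` is independent from `b`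
over `M`. -/
theorem StrongFiniteCharacterOverModels.ind_of_realizesLimitType
    (hsfc : StrongFiniteCharacterOverModels L κ Ind) (hex : ExistenceOverModels L κ Ind)
    (hmono : MonotonicityOverModels L κ Ind) (hsymm : SymmetryOverModels L κ Ind)
    {M : L.ElementarySubstructure 𝕄} (hM : #M < κ) {n k : ℕ} {e : Fin n → 𝕄} {b : Fin k → 𝕄}
    {I : Type*} {U : Ultrafilter I} {x : I → Fin n → 𝕄} (hx : ∀ i j, x i j ∈ M)
    (he : RealizesLimitType L ((M : Set 𝕄) ∪ Set.range b) U x e) :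
    Ind (Set.range e) M (Set.range b) := by
  by_contra hn
  obtain ⟨ψ, hψ, hψ'⟩ := hsfc M hM n k e b hn
  let t : M ⊕ (Fin k ⊕ Fin n) → ((M : Set 𝕄) ∪ Set.range b : Set 𝕄) ⊕ Fin n :=
    Sum.elim (fun a => .inl ⟨a, Or.inl a.2⟩) (Sum.elim (fun j => .inl ⟨b j, Or.inr ⟨j, rfl⟩⟩) .inr)
  have et : ∀ y : Fin n → 𝕄, Sum.elim (↑) y ∘ t =
      Sum.elim ((↑) : M → 𝕄) (Sum.elim b y) := fun y => by ext (a | j | j) <;> rfl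
  have := he.realize_comp ψ t
  simp only [et] at this
  obtain ⟨i, hi⟩ := (this.1 hψ).exists
  refine hψ' (x i) hi ((hsymm M hM _ _ _ _).1 ?_)
  have hr : Set.range (x i) ⊆ M := Set.range_subset_iff.2 (hx i)
  -- As `x i` lies in `M`, adjoining it to `M` changes nothing, and existence for `b` applies.
  refine hmono M hM k 0 b Fin.elim0 (Set.range (x i)) M ((mk_le_mk_of_subset hr).trans_lt hM) hM ?_
  rw [Set.range_eq_empty (Fin.elim0 : Fin 0 → 𝕄), Set.union_empty, Set.union_eq_self_of_subset_left hr]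
  exact hex M hM k b

end Independence

end FirstOrder.Language

namespace FirstOrder.Language

open Filter

/-! ### The contradiction with independent amalgamation. -/

section Amalgamation

variable {L : Language.{u, v}} {𝕄 : Type w} [L.Structure 𝕄] {κ : Cardinal.{w}}
  {Ind : Set 𝕄 → Set 𝕄 → Set 𝕄 → Prop}

theorem IsMonster.aleph0_lt (h : IsMonster L 𝕄 κ) : ℵ₀ < κ := by
  rw [← Cardinal.lift_lt.{w, max u v}]
  exact lt_of_le_of_lt (by simp) h.card_lt

/-- If `d` and `e` have the same type over `M` and `b` is independent from `d` over `M`, then there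
is a conjugate of `b` over `M` in the same position over `e`. -/
theorem IsMonster.exists_conjugate (h : IsMonster L 𝕄 κ) (hinv : IsAutInvariant L κ Ind)
    {M : L.ElementarySubstructure 𝕄} (hM : #M < κ) {k m : ℕ} {d e : Fin m → 𝕄} {b : Fin k → 𝕄}
    (hde : SameTypeOver L (M : Set 𝕄) d e) (hb : Ind (Set.range b) M (Set.range d))
    {φ : L.Formula (Fin k ⊕ Fin m)} (hφ : φ.Realize (Sum.elim b d)) :
    ∃ b' : Fin k → 𝕄, SameTypeOver L (M : Set 𝕄) b b' ∧ Ind (Set.range b') M (Set.range e) ∧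
      φ.Realize (Sum.elim b' e) := by
  obtain ⟨σ, hσ, rfl⟩ := h.homogeneous.exists_automorphism h.aleph0_lt.le hM hde
  have hsmall : ∀ {n : ℕ} (f : Fin n → 𝕄), #(Set.range f) < κ := fun f =>
    (mk_lt_aleph0_iff.2 inferInstance).trans h.aleph0_lt
  refine ⟨σ ∘ b, sameTypeOver_of_automorphism σ hσ b, ?_, ?_⟩
  · have := (hinv σ _ _ _ (hsmall b) (hsmall d) hM).1 hb
    rwa [← Set.range_comp, ← Set.range_comp,
      show σ '' (M : Set 𝕄) = M from (Set.image_congr hσ).trans (Set.image_id' _)] at this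
  · rw [← Sum.comp_elim, StrongHomClass.realize_formula]
    exact hφ

/-- Two sequences over a small model whose types have the same limit, one with consistent instances
of `φ` and the other with pairwise inconsistent ones, contradict independent amalgamation. -/
theorem IsMonster.false_of_array [Nonempty 𝕄] (h : IsMonster L 𝕄 κ)
    (hinv : IsAutInvariant L κ Ind)
    (hsfc : StrongFiniteCharacterOverModels L κ Ind)
    (hex : ExistenceOverModels L κ Ind)
    (hmono : MonotonicityOverModels L κ Ind)
    (hsymm : SymmetryOverModels L κ Ind)
    (ham : IndependentAmalgamationOverModels L κ Ind)
    {k m : ℕ} {φ : L.Formula (Fin k ⊕ Fin m)} {M : L.ElementarySubstructure 𝕄} (hM : #M < κ)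
    {c₀ c₁ : ℕ → Fin m → 𝕄} (hc₀M : ∀ i j, c₀ i j ∈ M) (hc₁M : ∀ i j, c₁ i j ∈ M)
    (hc₀ : ∀ n, ∃ x : Fin k → 𝕄, ∀ i < n, φ.Realize (Sum.elim x (c₀ i)))
    (hc₁ : ∀ i j, i < j → ¬ InstancesRealized φ [c₁ i, c₁ j])
    (htp : ∀ ψ : L.Formula ((M : Set 𝕄) ⊕ Fin m),
      ∀ᶠ n in atTop, (ψ.Realize (Sum.elim (↑) (c₀ n)) ↔ ψ.Realize (Sum.elim (↑) (c₁ n)))) :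
    False := by
  have hκ := h.aleph0_lt.le
  have hsmall : ∀ {n : ℕ} (f : Fin n → 𝕄), #((M : Set 𝕄) ∪ Set.range f : Set 𝕄) < κ := fun f =>
    (mk_union_le _ _).trans_lt
      (add_lt_of_lt hκ hM ((mk_lt_aleph0_iff.2 inferInstance).trans_le hκ))
  let U : Ultrafilter ℕ := hyperfilter ℕ
  have hU : (U : Filter ℕ) ≤ atTop := Nat.hyperfilter_le_atTop
  choose x hx using hc₀
  -- The order of the limits matters: `b` satisfies every φ(x; c₀ i), so `d`, a limit over `M` and
  -- `b`, satisfies φ(b; d). Likewise `e₁` is inconsistent with every `c₁ i`, so `e₀`, a limit over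
  -- `M` and `e₁`, is inconsistent with `e₁`.
  obtain ⟨b, hb⟩ := h.saturated.exists_realizesLimitType hκ (A := (M : Set 𝕄)) hM U x
  obtain ⟨d, hd⟩ := h.saturated.exists_realizesLimitType hκ (hsmall b) U c₀
  obtain ⟨e₁, he₁⟩ := h.saturated.exists_realizesLimitType hκ (A := (M : Set 𝕄)) hM U c₁
  obtain ⟨e₀, he₀⟩ := h.saturated.exists_realizesLimitType hκ (hsmall e₁) U c₁
  have restrict : ∀ {n : ℕ} {f : Fin n → 𝕄} {y : ℕ → Fin m → 𝕄} {e : Fin m → 𝕄},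
      RealizesLimitType L ((M : Set 𝕄) ∪ Set.range f) U y e →
        RealizesLimitType L (M : Set 𝕄) U y e := by
    intro n f y e he ψ
    have e' : ∀ z : Fin m → 𝕄, Sum.elim ((↑) : ((M : Set 𝕄) ∪ Set.range f : Set 𝕄) → 𝕄) z ∘
        Sum.map (Set.inclusion Set.subset_union_left) id = Sum.elim ((↑) : ↥(M : Set 𝕄) → 𝕄) z :=
      fun z => by ext (a | j) <;> rfl
    simpa only [e'] using he.realize_comp ψ (Sum.map (Set.inclusion Set.subset_union_left) id)
  have hde₁ : SameTypeOver L (M : Set 𝕄) d e₁ := fun ψ =>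
    (restrict hd ψ).trans (Iff.trans (eventually_congr ((htp ψ).filter_mono hU)) (he₁ ψ).symm)
  have hde₀ : SameTypeOver L (M : Set 𝕄) d e₀ := hde₁.trans fun ψ =>
    (he₁ ψ).trans (restrict he₀ ψ).symm
  have hbc : ∀ i, φ.Realize (Sum.elim b (c₀ i)) := by
    intro i
    have e : ∀ z : Fin k → 𝕄, Sum.elim ((↑) : ↥(M : Set 𝕄) → 𝕄) z ∘
        Sum.elim .inr (fun j => .inl ⟨c₀ i j, hc₀M i j⟩) = Sum.elim z (c₀ i) :=
      fun z => by ext (a | j) <;> rfl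
    rw [← e, hb.realize_comp]
    simp only [e]
    exact ((eventually_gt_atTop i).filter_mono hU).mono fun n hn => hx n i hn
  have hbd : φ.Realize (Sum.elim b d) := by
    have e : ∀ z : Fin m → 𝕄, Sum.elim ((↑) : ((M : Set 𝕄) ∪ Set.range b : Set 𝕄) → 𝕄) z ∘
        Sum.elim (fun j => .inl ⟨b j, Or.inr ⟨j, rfl⟩⟩) .inr = Sum.elim b z :=
      fun z => by ext (a | j) <;> rfl
    rw [← e, hd.realize_comp]
    simp only [e]
    exact Eventually.of_forall hbc
  have hce₁ : ∀ i, ¬ InstancesRealized φ [c₁ i, e₁] := fun i =>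
    (he₁.instancesRealized φ [fun j => .inl ⟨c₁ i j, hc₁M i j⟩, .inr]).not.2
      (Ultrafilter.eventually_not.1
        (((eventually_gt_atTop i).filter_mono hU).mono fun j hj => hc₁ i j hj))
  have hee : ¬ InstancesRealized φ [e₀, e₁] :=
    (he₀.instancesRealized φ [.inr, fun j => .inl ⟨e₁ j, Or.inr ⟨j, rfl⟩⟩]).not.2
      (Ultrafilter.eventually_not.1 (Eventually.of_forall hce₁))
  have hInd_e : Ind (Set.range e₀) M (Set.range e₁) :=
    hsfc.ind_of_realizesLimitType hex hmono hsymm hM hc₁M he₀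
  have hInd_b : Ind (Set.range b) M (Set.range d) := (hsymm M hM _ _ _ _).1
    (hsfc.ind_of_realizesLimitType hex hmono hsymm hM hc₀M hd)
  obtain ⟨b₀, hb₀, hi₀, hφ₀⟩ := h.exists_conjugate hinv hM hde₀ hInd_b hbd
  obtain ⟨b₁, hb₁, hi₁, hφ₁⟩ := h.exists_conjugate hinv hM hde₁ hInd_b hbd
  obtain ⟨b', hb'₀, hb'₁⟩ := ham M hM k m m b₀ b₁ e₀ e₁ hInd_e hi₀ hi₁ (hb₀.symm.trans hb₁)
  have transfer : ∀ {e : Fin m → 𝕄} {f : Fin k → 𝕄},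
      SameTypeOver L (Set.range e ∪ (M : Set 𝕄)) b' f →
      φ.Realize (Sum.elim f e) → φ.Realize (Sum.elim b' e) := by
    intro e f hf hφ
    let t : Fin k ⊕ Fin m → (Set.range e ∪ (M : Set 𝕄) : Set 𝕄) ⊕ Fin k :=
      Sum.elim .inr fun j => .inl ⟨e j, Or.inl ⟨j, rfl⟩⟩
    have et : ∀ z : Fin k → 𝕄, Sum.elim (↑) z ∘ t = Sum.elim z e :=
      fun z => by ext (a | j) <;> rfl
    have := hf (φ.relabel t)
    rw [Formula.realize_relabel, Formula.realize_relabel, et, et] at this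
    exact this.2 hφ
  refine hee ⟨b', fun c hc => ?_⟩
  obtain rfl | rfl : c = e₀ ∨ c = e₁ := by simpa using hc
  exacts [transfer hb'₀ hφ₀, transfer hb'₁ hφ₁]

end Amalgamation

end FirstOrder.Language

theorem mainTheorem5 {L : FirstOrder.Language.{u, v}} (T : L.Theory) (hT : T.IsComplete)
    (𝕄 : Type w) [L.Structure 𝕄] [Nonempty 𝕄] [𝕄 ⊨ T]
    (κ : Cardinal.{w}) (h𝕄 : IsMonster L 𝕄 κ)
    (Ind : Set 𝕄 → Set 𝕄 → Set 𝕄 → Prop)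
    (hinv : IsAutInvariant L κ Ind)
    (hsfc : StrongFiniteCharacterOverModels L κ Ind)
    (hex : ExistenceOverModels L κ Ind)
    (hmono : MonotonicityOverModels L κ Ind)
    (hsymm : SymmetryOverModels L κ Ind)
    (ham : IndependentAmalgamationOverModels L κ Ind) :
    T.IsNSOP1 := by
  rintro ⟨k, m, φ, N, hN⟩
  have hκ := h𝕄.aleph0_lt.le
  obtain ⟨a, ha⟩ := hN.exists_isSOP1TreeAbove
  obtain ⟨a', ha'⟩ := ha.exists_of_isComplete h𝕄.saturated hκ hT
  -- Types are compared over Skolem hulls, not just over the earlier terms, so that the agreement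
  -- reaches every parameter of the final model.
  obtain ⟨c₀, c₁, hc₀, hc₁, htp⟩ := ha'.exists_array h𝕄.saturated hκ
    (fun s => (skolemHull L s : Set 𝕄)) (subset_skolemHull L)
    fun s hs => mk_skolemHull_lt L h𝕄.card_lt hs.countable
  let S : ℕ → Set 𝕄 := fun n => ⋃ i < n, Set.range (c₀ i) ∪ Set.range (c₁ i)
  have hS : Monotone S := fun n n' hn =>
    Set.biUnion_subset_biUnion_left fun i hi => lt_of_lt_of_le hi hn
  have hcount : (⋃ n, S n).Countable := Set.countable_iUnion fun n =>
    Set.countable_iUnion fun i => Set.countable_iUnion fun _ =>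
      (Set.countable_range _).union (Set.countable_range _)
  have hsub : ∀ i, Set.range (c₀ i) ∪ Set.range (c₁ i) ⊆ skolemHull L (⋃ n, S n) := fun i y hy =>
    subset_skolemHull L _ (Set.mem_iUnion.2 ⟨i + 1, Set.mem_biUnion (Nat.lt_succ_self i) hy⟩)
  exact h𝕄.false_of_array hinv hsfc hex hmono hsymm ham
    (mk_skolemHull_lt L h𝕄.card_lt hcount)
    (fun i j => hsub i (Or.inl ⟨j, rfl⟩)) (fun i j => hsub i (Or.inr ⟨j, rfl⟩)) hc₀ hc₁
    (eventually_realize_iff_of_sameTypeOver L hS htp)
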